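/- Let $\mathbb K$ be an algebraically closed field of characteristic $0$, let $k\ge 1$, and let $Y=\mathbb P^{n_1}\times\cdots\times\mathbb P^{n_k}$ with projections $\pi_i\colon Y\to\mathbb P^{n_i}$. Say that $Y$ is the minimal multiprojective space containing a finite set $S\subset Y$ if, for every $i$, $\#\pi_i(S)>1$ and the linear span of $\pi_i(S)$ is $\mathbb P^{n_i}$. For a finite set $S\subset Y$ let $(2S,Y)$ be the union of the first infinitesimal neighbourhoods in $Y$ of the points of $S$, and put $\delta(2S,Y)=h^1(\mathcal I_{(2S,Y)}(1,\dots,1))$. Let $\mathbb T_1(Y,3)$ be the set of all $S\subset Y$ with $\#S=3$, $h^0(\mathcal I_{(2S,Y)}(1,\dots,1))>0$ and $\delta(2S,Y)>0$, and let the third Terracini locus $\mathbb T(Y,3)$ be the set of all $S\in\mathbb T_1(Y,3)$ such that $Y$ is the minimal multiprojective space containing $S$. Assume that $Y$ is the minimal multiprojective space containing some set of $3$ points (so that $n_i\in\{1,2\}$ for all $i$). Then: 1. $\mathbb T(Y,3)$ is empty if and only if either $k\le 2$ (that is, $Y=\mathbb P^{n_1}$ or $Y=\mathbb P^{n_1}\times\mathbb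 P^{n_2}$ with $n_1,n_2\in\{1,2\}$), or at least three of the factors of $Y$ are planes $\mathbb P^2$ (for example $Y=(\mathbb P^2)^3$). 2. If $S\in\mathbb T(Y,3)$, then $Y=(\mathbb P^1)^4$, or $k\ge 3$ and, up to a permutation of the factors of $Y$, $S$ is one of the following configurations: (a) $Y=\mathbb P^m\times(\mathbb P^1)^{k-1}$ with $m\in\{1,2\}$, and $S=\{a,b,c\}$ with $\pi_1(a)\ne\pi_1(b)$, and $\pi_i(a)=\pi_i(b)\ne\pi_i(c)$ for all $i>1$; moreover $\dim\langle\pi_1(S)\rangle=2$ if $m=2$; (b) $Y=\mathbb P^{n_1}\times\mathbb P^{n_2}\times(\mathbb P^1)^{k-2}$ with $n_1,n_2\in\{1,2\}$, and $S=\{o,u,v\}$, where $\pi_i(u)=\pi_i(v)\ne\pi_i(o)$ for all $i>2$, and for $j=1,2$ the points $\pi_j(u),\pi_j(v)$ span a line $L_j\subseteq\mathbb P^{n_j}$, with $\pi_j(o)\notin L_j$ if $n_j=2$. 3. If $Y=(\mathbb P^1)^4$, then every $S\subset Y$ with $\#S=3$ lies in $\mathbb T_1(Y,3)$; hence every such $S$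 for which $Y$ is the minimal multiprojective space containing $S$ lies in $\mathbb T(Y,3)$. -/

import Mathlib

open scoped LinearAlgebra.Projectivization

noncomputable section

namespace Multiproj

variable (K : Type*) [Field K] {k : ℕ} (n : Fin k → ℕ)

/-- The (closed) points of the multiprojective space `Y = ℙ^{n₁} × ⋯ × ℙ^{n_k}` over `K`. -/
abbrev Point : Type _ := ∀ i : Fin k, ℙ K (Fin (n i + 1) → K)

/-- `H⁰(Y, 𝒪_Y(1,…,1))`: the multilinear forms on `K^{n₁+1} × ⋯ × K^{n_k+1}`. -/
abbrev Form : Type _ := MultilinearMap K (fun i : Fin k => Fin (n i + 1) → K) K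

variable {K n}

/-- The linear span of a set of points of a projective space, as a vector subspace
(its projective dimension is its `finrank` minus one). -/
def linSpan {V : Type*} [AddCommGroup V] [Module K V] (A : Set (ℙ K V)) : Submodule K V :=
  ⨆ p ∈ A, p.submodule

/-- `H⁰((2p,Y), 𝒪(1,…,1))`, where `(2p,Y)` is the first infinitesimal neighbourhood of `p` in `Y`
(ideal sheaf `(ℐ_p)²`).  Put `vᵢ = (p i).rep`.  A section over `(2p,Y)` is a first-order jet, at
`v = (v₁,…,v_k)`, of a function that is homogeneous of degree one in each of the `k` groups of
variables: its value `x.1` and its partial derivatives `x.2 i j` (the `j`-th variable of the `i`-th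
group), which are tied together by the Euler relation in each group of variables.
This space has dimension `n₁ + ⋯ + n_k + 1`, the degree of `(2p,Y)`. -/
def jets (p : Point K n) : Submodule K (K × (∀ i : Fin k, Fin (n i + 1) → K)) where
  carrier := {x | ∀ i, ∑ j, (p i).rep j * x.2 i j = x.1}
  add_mem' := by
    intro x y hx hy i
    simp [mul_add, Finset.sum_add_distrib, hx i, hy i]
  zero_mem' := by
    intro i
    simp
  smul_mem' := by
    intro c x hx i
    simp [← hx i, Finset.mul_sum, mul_left_comm]

/-- Restriction of a form `f` to the double point `(2p,Y)`: its value `f(v)` together with its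
partial derivatives `f(v₁,…,v_{i-1},eⱼ,v_{i+1},…,v_k)` at `v`, where `vᵢ = (p i).rep` and `eⱼ` is
the `j`-th vector of the standard basis. -/
def restrictPoint (p : Point K n) : Form K n →ₗ[K] jets p where
  toFun f := ⟨(f fun i => (p i).rep,
      fun i j => f (Function.update (fun l => (p l).rep) i (Pi.single j 1))), by
    intro i
    have h := congrArg (f.toLinearMap (fun l => (p l).rep) i) (pi_eq_sum_univ' (p i).rep)
    simp only [map_sum, map_smul, smul_eq_mul, MultilinearMap.toLinearMap_apply,
      Function.update_eq_self] at h
    simpa [Pi.single_apply, Pi.single, Function.update, eq_comm] using h.symm⟩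
  map_add' f g := by
    ext <;> simp
  map_smul' c f := by
    ext <;> simp

/-- The restriction map `H⁰(Y, 𝒪_Y(1,…,1)) → H⁰(Z, 𝒪_Z(1,…,1)) = ⊕_{p ∈ S} H⁰((2p,Y), 𝒪(1,…,1))`
for `Z = (2S,Y)`, the union of the double points supported at `S`. -/
def restrict (S : Set (Point K n)) : Form K n →ₗ[K] (∀ p : S, jets p.1) :=
  LinearMap.pi fun p => restrictPoint p.1

/-- `h⁰(ℐ_{(2S,Y)}(1,…,1))` for a finite set `S`.  The sheaf `ℐ_Z(1,…,1)` has the resolution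
`𝒪_Y(1,…,1) → 𝒪_Z(1,…,1)` by sheaves without higher cohomology, so its cohomology is that of the
two-term complex `restrict S`; in degree zero this is the kernel, i.e. the space of the
multilinear forms that vanish on `(2S,Y)`. -/
def h0 (S : Set (Point K n)) : ℕ :=
  Module.finrank K (LinearMap.ker (restrict S))

/-- The Terracini defect `δ(2S,Y) = h¹(ℐ_{(2S,Y)}(1,…,1))` of a finite set `S`: the dimension of
the cohomology in degree one (the cokernel) of the complex
`H⁰(Y, 𝒪_Y(1,…,1)) → H⁰(Z, 𝒪_Z(1,…,1))`, `Z = (2S,Y)`. -/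
def defect (S : Set (Point K n)) : ℕ :=
  Module.finrank K ((∀ p : S, jets p.1) ⧸ LinearMap.range (restrict S))

/-- `Y` is the minimal multiprojective space containing `S`: no projection `π_i(S)` is a single
point (so that no factor is dropped), and `⟨π_i(S)⟩` is the whole factor `ℙ^{n_i}` for all `i`. -/
def IsMinimalFor (S : Set (Point K n)) : Prop :=
  ∀ i : Fin k, ((fun p : Point K n => p i) '' S).Nontrivial ∧
    linSpan ((fun p : Point K n => p i) '' S) = ⊤

variable (K n)

/-- `𝕋₁(Y,r)`. -/
def terraciniOne (r : ℕ) : Set (Set (Point K n)) :=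
  {S | S.ncard = r ∧ S.Finite ∧ 0 < h0 S ∧ 0 < defect S}

/-- The `r`-th Terracini locus `𝕋(Y,r)`. -/
def terracini (r : ℕ) : Set (Set (Point K n)) :=
  {S | S ∈ terraciniOne K n r ∧ IsMinimalFor S}

variable {K n}

/-- The first family of configurations.  After a permutation of the factors,
`Y = ℙ^m × (ℙ¹)^{k-1}` with `k ≥ 3` and `m ∈ {1,2}` (`i₀` is the index of the factor `ℙ^m`), and
`S = {a,b,c}` where `a` and `b` differ exactly in the factor `ℙ^m`, and `c` differs from them in
every other factor; if `m = 2`, the projection of `S` to `ℙ^m` spans the plane. -/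
def IsFirstExample (S : Set (Point K n)) : Prop :=
  3 ≤ k ∧ ∃ i₀ : Fin k, (n i₀ = 1 ∨ n i₀ = 2) ∧ (∀ i, i ≠ i₀ → n i = 1) ∧
    ∃ a b c : Point K n, S = {a, b, c} ∧ a i₀ ≠ b i₀ ∧
      (∀ i, i ≠ i₀ → a i = b i ∧ a i ≠ c i) ∧
      (n i₀ = 2 → Module.finrank K (linSpan ((fun p : Point K n => p i₀) '' S)) = 3)

/-- The second family of configurations.  After a permutation of the factors,
`Y = ℙ^{m₁} × ℙ^{m₂} × (ℙ¹)^{k-2}` with `k ≥ 3` and `m₁, m₂ ∈ {1,2}` (`i₁ ≠ i₂` are the indices of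
the first two factors), and `S = {o,u,v}` where `u` and `v` agree in the remaining `k-2` factors
and project to two points spanning a line in each of the two special factors, while `o` differs
from `u` in the remaining `k-2` factors and, in each special factor that is a plane, projects to a
point outside that line. -/
def IsSecondExample (S : Set (Point K n)) : Prop :=
  3 ≤ k ∧ ∃ i₁ i₂ : Fin k, i₁ ≠ i₂ ∧
    ∃ o u v : Point K n, S = {o, u, v} ∧
      (∀ j, j = i₁ ∨ j = i₂ → (n j = 1 ∨ n j = 2) ∧
        Module.finrank K (linSpan {u j, v j}) = 2 ∧
        (n j = 2 → ¬ (o j).submodule ≤ linSpan {u j, v j})) ∧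
      (∀ j, j ≠ i₁ → j ≠ i₂ → n j = 1 ∧ u j = v j ∧ o j ≠ u j)

end Multiproj

end

/-! Here `h0` is positive when a nonzero multilinear form is singular at the three points, and
`defect` is positive when first-order jets at the three points cannot be prescribed independently.

Jets are prescribed with products of linear forms. Such a product is singular at a point where two
of its factors vanish, so to isolate the jet at one point `v` one distributes two zeros for each of
the other points `a`, `b` over the factors, using linear forms that do not vanish at `v`. A plane
can take a zero for both `a` and `b`, because the three projections are independent there; any other
factor is only assumed to take one. The count closes once each pair of points differs in at least
three factors and `k` plus the number of planes is at least 5 (`defect_eq_zero`).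

What remains is small. A pair differing in at most two factors gives one of the two families
(`isExample_of_card_le_two`). For `k ≤ 2`, or for `k = 3` with at most one plane and all pairs
differing everywhere, no nonzero form is singular at the three points (`eq_zero_of_le_two`,
`eq_zero_of_two_lines`). Only `(ℙ¹)⁴` is left. Three planes force every pair to differ in three
factors, hence zero defect.

Nonemptiness comes from coordinate points, two of which differ in exactly two factors: one
coefficient of the form then occurs in both of their jets (`terracini_nonempty`).

On `(ℙ¹)⁴` there are at most 16 coefficients and at least 15 conditions. Independent conditions
would leave at most one singular form up to scalars, and products of bilinear forms, one for each
way of pairing the factors, rule this out (`not_forall_proportional`). -/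

open scoped LinearAlgebra.Projectivization

namespace Multiproj

section

variable {K : Type*} [Field K] {k : ℕ} {n : Fin k → ℕ}

/-! ### Singular forms and the restriction map. -/

/-- The multilinear form `f` vanishes to order at least two at the point with coordinates `v`. -/
def SingularAt (f : Form K n) (v : ∀ i, Fin (n i + 1) → K) : Prop :=
  ∀ i x, f (Function.update v i x) = 0

theorem SingularAt.apply_self {f : Form K n} {v : ∀ i, Fin (n i + 1) → K} (h : SingularAt f v)
    (hk : 0 < k) : f v = 0 := by
  simpa using h ⟨0, hk⟩ (v ⟨0, hk⟩)

theorem SingularAt.add {f g : Form K n} {v : ∀ i, Fin (n i + 1) → K} (hf : SingularAt f v)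
    (hg : SingularAt g v) : SingularAt (f + g) v := fun i x => by
  simp [hf i x, hg i x]

theorem SingularAt.smul {f : Form K n} {v : ∀ i, Fin (n i + 1) → K} (hf : SingularAt f v)
    (c : K) : SingularAt (c • f) v := fun i x => by
  simp [hf i x]

theorem SingularAt.sum {ι : Type*} {s : Finset ι} {f : ι → Form K n}
    {v : ∀ i, Fin (n i + 1) → K} (hf : ∀ a ∈ s, SingularAt (f a) v) :
    SingularAt (∑ a ∈ s, f a) v := fun i x => by
  rw [sum_apply]
  exact Finset.sum_eq_zero fun a ha => hf a ha i x

theorem singularAt_iff_basis {f : Form K n} {v : ∀ i, Fin (n i + 1) → K} :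
    SingularAt f v ↔ ∀ i j, f (Function.update v i (Pi.single j 1)) = 0 := by
  refine ⟨fun h i j => h i _, fun h i x => ?_⟩
  have h0 : f.toLinearMap v i = 0 := by
    refine (Pi.basisFun K _).ext fun j => ?_
    simpa using h i j
  simpa using LinearMap.congr_fun h0 x

theorem restrictPoint_eq_iff {p : Point K n} {f : Form K n} {x : jets p} :
    restrictPoint p f = x ↔ (f fun i => (p i).rep) = x.1.1 ∧
      ∀ i j, f (Function.update (fun l => (p l).rep) i (Pi.single j 1)) = x.1.2 i j := by
  rw [Subtype.ext_iff, Prod.ext_iff, funext_iff]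
  simp only [funext_iff]
  rfl

/-- With at least one factor, Euler's relation makes the value vanish as soon as the partial
derivatives do. -/
theorem restrictPoint_eq_zero_iff (hk : 0 < k) {p : Point K n} {f : Form K n} :
    restrictPoint p f = 0 ↔ SingularAt f fun i => (p i).rep := by
  rw [restrictPoint_eq_iff, singularAt_iff_basis]
  refine ⟨fun h => h.2, fun h => ⟨(singularAt_iff_basis.2 h).apply_self hk, h⟩⟩

theorem mem_ker_restrict_iff (hk : 0 < k) {S : Set (Point K n)} {f : Form K n} :
    f ∈ LinearMap.ker (restrict S) ↔ ∀ p ∈ S, SingularAt f fun i => (p i).rep := by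
  rw [LinearMap.mem_ker, funext_iff]
  constructor
  · intro h p hp
    exact (restrictPoint_eq_zero_iff hk).1 (h ⟨p, hp⟩)
  · intro h p
    exact (restrictPoint_eq_zero_iff hk).2 (h p.1 p.2)

theorem h0_pos_iff (hk : 0 < k) {S : Set (Point K n)} :
    0 < h0 S ↔ ∃ f : Form K n, f ≠ 0 ∧ ∀ p ∈ S, SingularAt f fun i => (p i).rep := by
  rw [h0, Module.finrank_pos_iff (R := K) (M := LinearMap.ker (restrict S)),
    Submodule.nontrivial_iff_ne_bot, Submodule.ne_bot_iff]
  simp only [mem_ker_restrict_iff hk]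
  exact ⟨fun ⟨f, h1, h2⟩ => ⟨f, h2, h1⟩, fun ⟨f, h1, h2⟩ => ⟨f, h2, h1⟩⟩

theorem defect_pos_iff {S : Set (Point K n)} (hS : S.Finite) :
    0 < defect S ↔ LinearMap.range (restrict S) ≠ ⊤ := by
  -- Finiteness of `S` makes the quotient finite-dimensional; otherwise `finrank` could be 0 by
  -- default.
  have := hS.to_subtype
  rw [defect, Module.finrank_pos_iff, Submodule.Quotient.nontrivial_iff]

/-- Adding up forms that realize one jet each and are singular at the other points reduces
surjectivity to one point at a time. -/
theorem range_restrict_eq_top (hk : 0 < k) {S : Set (Point K n)} (hS : S.Finite)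
    (h : ∀ p ∈ S, ∀ x : jets p, ∃ f : Form K n, restrictPoint p f = x ∧
      ∀ q ∈ S, q ≠ p → SingularAt f fun i => (q i).rep) :
    LinearMap.range (restrict S) = ⊤ := by
  classical
  have := hS.fintype
  rw [LinearMap.range_eq_top]
  intro y
  choose f hf hf' using fun p : S => h p.1 p.2 (y p)
  refine ⟨∑ p, f p, funext fun q => ?_⟩
  change restrictPoint q.1 (∑ p, f p) = y q
  rw [map_sum, Finset.sum_eq_single q, hf]
  · intro p _ hp
    exact (restrictPoint_eq_zero_iff hk).2 (hf' p q.1 q.2 fun h => hp (Subtype.ext h.symm))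
  · simp

/-! ### Products of linear forms with a prescribed jet. -/

/-- The product of linear forms, one on each factor. -/
noncomputable def prodForm (l : ∀ i, Module.Dual K (Fin (n i + 1) → K)) : Form K n :=
  (MultilinearMap.mkPiAlgebra K (Fin k) K).compLinearMap l

theorem prodForm_apply (l : ∀ i, Module.Dual K (Fin (n i + 1) → K))
    (v : ∀ i, Fin (n i + 1) → K) : prodForm l v = ∏ i, l i (v i) := rfl

theorem singularAt_prodForm {l : ∀ i, Module.Dual K (Fin (n i + 1) → K)}
    {v : ∀ i, Fin (n i + 1) → K} {i j : Fin k} (hij : i ≠ j) (hi : l i (v i) = 0)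
    (hj : l j (v j) = 0) : SingularAt (prodForm l) v := by
  intro m x
  rw [prodForm_apply]
  by_cases h : i = m
  · refine Finset.prod_eq_zero (Finset.mem_univ j) ?_
    rw [Function.update_of_ne (fun h' => hij (h.trans h'.symm)), hj]
  · refine Finset.prod_eq_zero (Finset.mem_univ i) ?_
    rw [Function.update_of_ne h, hi]

open Classical in
theorem singularAt_prodForm_of_card {l : ∀ i, Module.Dual K (Fin (n i + 1) → K)}
    {v : ∀ i, Fin (n i + 1) → K} (h : 2 ≤ (Finset.univ.filter fun i => l i (v i) = 0).card) :
    SingularAt (prodForm l) v := by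
  obtain ⟨i, hi, j, hj, hij⟩ := Finset.one_lt_card.1 h
  exact singularAt_prodForm hij (Finset.mem_filter.1 hi).2 (Finset.mem_filter.1 hj).2

/-- Elements of `W` may serve both sets, the other elements of `U ∪ V` only one. So `A` receives `U
\ V` and `W`, plus just enough of `(U ∩ V) \ W` to reach `r`, and `B` receives the rest. -/
theorem exists_subsets_inter_subset {ι : Type*} [DecidableEq ι] (U V W : Finset ι) (hU : W ⊆ U)
    (hV : W ⊆ V) {r s : ℕ} (hr : r ≤ U.card) (hs : s ≤ V.card)
    (hrs : r + s ≤ (U ∪ V).card + W.card) :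
    ∃ A ⊆ U, ∃ B ⊆ V, A ∩ B ⊆ W ∧ r ≤ A.card ∧ s ≤ B.card := by
  set M := (U ∩ V) \ W with hM
  have hWi : W ⊆ U ∩ V := Finset.subset_inter hU hV
  have h1 : M.card + W.card = (U ∩ V).card := by
    rw [hM, Finset.card_sdiff_add_card_eq_card hWi]
  have h2 := Finset.card_sdiff_add_card_inter U V
  have h3 := Finset.card_sdiff_add_card_inter V U
  rw [Finset.inter_comm V U] at h3
  have h4 := Finset.card_union_add_card_inter U V
  obtain ⟨T, hTM, hT⟩ := Finset.exists_subset_card_eq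
    (s := M) (n := min M.card (r - (U \ V).card - W.card)) (min_le_left _ _)
  have hc := Finset.card_sdiff_add_card_eq_card hTM
  have hMU : M ⊆ U := fun x hx => by simp [hM] at hx; tauto
  have hMV : M ⊆ V := fun x hx => by simp [hM] at hx; tauto
  have hMW : Disjoint M W := Finset.sdiff_disjoint
  have hUV : U \ V ⊆ U := Finset.sdiff_subset
  have hVU : V \ U ⊆ V := Finset.sdiff_subset
  refine ⟨(U \ V) ∪ W ∪ T, ?_, (V \ U) ∪ W ∪ (M \ T), ?_, ?_, ?_, ?_⟩
  · exact Finset.union_subset (Finset.union_subset hUV hU) (hTM.trans hMU)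
  · exact Finset.union_subset (Finset.union_subset hVU hV) (Finset.sdiff_subset.trans hMV)
  · intro x hx
    have := @hTM x
    have := @hMU x
    have := @hMV x
    simp only [Finset.mem_inter, Finset.mem_union, Finset.mem_sdiff] at hx
    tauto
  · rw [Finset.card_union_of_disjoint, Finset.card_union_of_disjoint]
    · omega
    · exact Finset.disjoint_left.2 fun x hx hw => (Finset.mem_sdiff.1 hx).2 (hV hw)
    · refine Finset.disjoint_union_left.2 ⟨?_, (hMW.mono_left hTM).symm⟩
      exact Finset.disjoint_left.2 fun x hx hw => (Finset.mem_sdiff.1 hx).2 (hMV (hTM hw))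
  · rw [Finset.card_union_of_disjoint, Finset.card_union_of_disjoint]
    · omega
    · exact Finset.disjoint_left.2 fun x hx hw => (Finset.mem_sdiff.1 hx).2 (hU hw)
    · refine Finset.disjoint_union_left.2 ⟨?_, (hMW.mono_left Finset.sdiff_subset).symm⟩
      exact Finset.disjoint_left.2 fun x hx hw =>
        (Finset.mem_sdiff.1 hx).2 (hMU (Finset.sdiff_subset hw))

theorem exists_dual_eq_one {V : Type*} [AddCommGroup V] [Module K V] {N : Submodule K V} {v : V}
    (hv : v ∉ N) : ∃ l : Module.Dual K V, l v = 1 ∧ ∀ x ∈ N, l x = 0 := by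
  obtain ⟨f, hf, hN⟩ := Submodule.exists_le_ker_of_notMem hv
  refine ⟨(f v)⁻¹ • f, by simp [hf], fun x hx => ?_⟩
  simp [LinearMap.mem_ker.1 (hN hx)]

-- A linear form equal to 1 at `v i` can vanish at both `a i` and `b i` exactly when `v i` is
-- outside their span. Distributing `r` zeros at `a` and `s` zeros at `b` over `J` is thus the
-- preceding set problem.
open Classical in
theorem exists_dual_family {v a b : ∀ i, Fin (n i + 1) → K} (hv : ∀ i, v i ≠ 0)
    (J : Finset (Fin k)) {r s : ℕ}
    (hr : r ≤ (J.filter fun i => v i ∉ Submodule.span K {a i}).card)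
    (hs : s ≤ (J.filter fun i => v i ∉ Submodule.span K {b i}).card)
    (hab : ∀ i, v i ∉ Submodule.span K {a i} ∨ v i ∉ Submodule.span K {b i})
    (hrs : r + s ≤ J.card + (J.filter fun i => v i ∉ Submodule.span K {a i, b i}).card) :
    ∃ l : ∀ i, Module.Dual K (Fin (n i + 1) → K), (∀ i, l i (v i) = 1) ∧
      r ≤ (J.filter fun i => l i (a i) = 0).card ∧ s ≤ (J.filter fun i => l i (b i) = 0).card := by
  have hUV : (J.filter fun i => v i ∉ Submodule.span K {a i}) ∪
      (J.filter fun i => v i ∉ Submodule.span K {b i}) = J := by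
    ext i
    have := hab i
    simp only [Finset.mem_union, Finset.mem_filter]
    tauto
  obtain ⟨A, hA, B, hB, hAB, hrA, hsB⟩ := exists_subsets_inter_subset
    (J.filter fun i => v i ∉ Submodule.span K {a i})
    (J.filter fun i => v i ∉ Submodule.span K {b i})
    (J.filter fun i => v i ∉ Submodule.span K {a i, b i})
    (Finset.monotone_filter_right _ fun i _ h h' => h (Submodule.span_mono (by simp) h'))
    (Finset.monotone_filter_right _ fun i _ h h' => h (Submodule.span_mono (by simp) h'))
    hr hs (by rwa [hUV])
  have key : ∀ i, ∃ l : Module.Dual K (Fin (n i + 1) → K), l (v i) = 1 ∧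
      (i ∈ A → l (a i) = 0) ∧ (i ∈ B → l (b i) = 0) := by
    intro i
    by_cases hiA : i ∈ A <;> by_cases hiB : i ∈ B
    · obtain ⟨l, h1, h2⟩ := exists_dual_eq_one
        (Finset.mem_filter.1 (hAB (Finset.mem_inter.2 ⟨hiA, hiB⟩))).2
      exact ⟨l, h1, fun _ => h2 _ (Submodule.subset_span (by simp)),
        fun _ => h2 _ (Submodule.subset_span (by simp))⟩
    · obtain ⟨l, h1, h2⟩ := exists_dual_eq_one (Finset.mem_filter.1 (hA hiA)).2
      exact ⟨l, h1, fun _ => h2 _ (Submodule.subset_span (by simp)), fun h => absurd h hiB⟩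
    · obtain ⟨l, h1, h2⟩ := exists_dual_eq_one (Finset.mem_filter.1 (hB hiB)).2
      exact ⟨l, h1, fun h => absurd h hiA, fun _ => h2 _ (Submodule.subset_span (by simp))⟩
    · obtain ⟨l, h1, -⟩ := exists_dual_eq_one (N := (⊥ : Submodule K _))
        (fun h => hv i ((Submodule.mem_bot K).1 h))
      exact ⟨l, h1, fun h => absurd h hiA, fun h => absurd h hiB⟩
  choose l h1 h2 h3 using key
  refine ⟨l, h1, hrA.trans (Finset.card_le_card fun i hi => ?_),
    hsB.trans (Finset.card_le_card fun i hi => ?_)⟩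
  · exact Finset.mem_filter.2 ⟨(Finset.mem_filter.1 (hA hi)).1, h2 i hi⟩
  · exact Finset.mem_filter.2 ⟨(Finset.mem_filter.1 (hB hi)).1, h3 i hi⟩

theorem prodForm_update_self {l : ∀ i, Module.Dual K (Fin (n i + 1) → K)}
    {v : ∀ i, Fin (n i + 1) → K} {i : Fin k} (hl : ∀ j, j ≠ i → l j (v j) = 1)
    (x : Fin (n i + 1) → K) : prodForm l (Function.update v i x) = l i x := by
  rw [prodForm_apply, Finset.prod_eq_single i, Function.update_self]
  · intro j _ hj
    rw [Function.update_of_ne hj, hl j hj]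
  · simp

theorem prodForm_update_of_ne {l : ∀ i, Module.Dual K (Fin (n i + 1) → K)}
    {v : ∀ i, Fin (n i + 1) → K} {i m : Fin k} (hi : l i (v i) = 0) (hm : m ≠ i)
    (x : Fin (n m + 1) → K) : prodForm l (Function.update v m x) = 0 := by
  rw [prodForm_apply]
  refine Finset.prod_eq_zero (Finset.mem_univ i) ?_
  rw [Function.update_of_ne hm.symm, hi]

-- Factor `i` is occupied by `w`, which carries the derivative, so the zeros go on the other `k - 1`
-- factors. If `w` already vanishes at `a i` or `b i`, one zero there suffices instead of two.
open Classical in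
theorem exists_prodForm_direction {v a b : ∀ i, Fin (n i + 1) → K} (hv : ∀ i, v i ≠ 0)
    (hab : ∀ i, v i ∉ Submodule.span K {a i} ∨ v i ∉ Submodule.span K {b i})
    (ha : 3 ≤ (Finset.univ.filter fun i => v i ∉ Submodule.span K {a i}).card)
    (hb : 3 ≤ (Finset.univ.filter fun i => v i ∉ Submodule.span K {b i}).card)
    (i : Fin k) {w : Module.Dual K (Fin (n i + 1) → K)} (hw : w (v i) = 0) {r s : ℕ}
    (hr : r = 2 ∨ r = 1 ∧ w (a i) = 0) (hs : s = 2 ∨ s = 1 ∧ w (b i) = 0)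
    (hrs : r + s + 1 ≤
      k + ((Finset.univ.erase i).filter fun j => v j ∉ Submodule.span K {a j, b j}).card) :
    ∃ f : Form K n, SingularAt f a ∧ SingularAt f b ∧
      (∀ x, f (Function.update v i x) = w x) ∧ ∀ m, m ≠ i → ∀ x, f (Function.update v m x) = 0 := by
  have herase : ∀ (P : Fin k → Prop) [DecidablePred P], 3 ≤ (Finset.univ.filter P).card →
      2 ≤ ((Finset.univ.erase i).filter P).card := by
    intro P _ hP
    rw [Finset.filter_erase]
    have := Finset.pred_card_le_card_erase (s := Finset.univ.filter P) (a := i)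
    omega
  have hk := i.pos
  obtain ⟨l, hl, hla, hlb⟩ := exists_dual_family hv (Finset.univ.erase i) (r := r) (s := s)
    (le_trans (by omega : r ≤ 2) (herase _ ha)) (le_trans (by omega : s ≤ 2) (herase _ hb)) hab (by
      rw [Finset.card_erase_of_mem (Finset.mem_univ i), Finset.card_univ, Fintype.card_fin]
      omega)
  have hsing : ∀ (c : ∀ j, Fin (n j + 1) → K) (t : ℕ), t = 2 ∨ t = 1 ∧ w (c i) = 0 →
      t ≤ ((Finset.univ.erase i).filter fun j => l j (c j) = 0).card →
      SingularAt (prodForm (Function.update l i w)) c := by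
    intro c t ht hc
    have hsub : ((Finset.univ.erase i).filter fun j => l j (c j) = 0) ⊆
        Finset.univ.filter fun j => Function.update l i w j (c j) = 0 := by
      intro j hj
      simp only [Finset.mem_filter, Finset.mem_erase, Finset.mem_univ, and_true, true_and] at hj ⊢
      rw [Function.update_of_ne hj.1, hj.2]
    refine singularAt_prodForm_of_card ?_
    rcases ht with rfl | ⟨rfl, hw0⟩
    · exact hc.trans (Finset.card_le_card hsub)
    -- The index `i`, excluded from the count over the other factors, supplies the second zero.
    · refine Nat.lt_of_le_of_lt hc (Finset.card_lt_card ?_)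
      refine (Finset.ssubset_iff_of_subset hsub).2 ⟨i, ?_, ?_⟩
      · simp [hw0]
      · simp
  refine ⟨_, hsing a r hr hla, hsing b s hs hlb, fun x => ?_, fun m hm x => ?_⟩
  · rw [prodForm_update_self, Function.update_self]
    intro j hj
    rw [Function.update_of_ne hj, hl]
  · exact prodForm_update_of_ne (i := i) (by rw [Function.update_self, hw]) hm x

-- If factor `i` is a plane, using it for the derivative loses the double zero it could have held.
-- Splitting `w` into a part vanishing at `a i` and a part vanishing at `b i` saves one zero in each
-- part and restores the bound 5.
open Classical in
theorem exists_form_direction {v a b : ∀ i, Fin (n i + 1) → K} (hv : ∀ i, v i ≠ 0)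
    (hab : ∀ i, v i ∉ Submodule.span K {a i} ∨ v i ∉ Submodule.span K {b i})
    (ha : 3 ≤ (Finset.univ.filter fun i => v i ∉ Submodule.span K {a i}).card)
    (hb : 3 ≤ (Finset.univ.filter fun i => v i ∉ Submodule.span K {b i}).card)
    (hplane : ∀ i, n i = 2 →
      v i ∉ Submodule.span K {a i, b i} ∧ b i ∉ Submodule.span K {v i, a i})
    (hk : 5 ≤ k + (Finset.univ.filter fun i => n i = 2).card)
    (i : Fin k) {w : Module.Dual K (Fin (n i + 1) → K)} (hw : w (v i) = 0) :
    ∃ f : Form K n, SingularAt f a ∧ SingularAt f b ∧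
      (∀ x, f (Function.update v i x) = w x) ∧ ∀ m, m ≠ i → ∀ x, f (Function.update v m x) = 0 := by
  have hsub : ((Finset.univ.filter fun i => n i = 2).erase i).card ≤
      ((Finset.univ.erase i).filter fun j => v j ∉ Submodule.span K {a j, b j}).card := by
    rw [← Finset.filter_erase]
    exact Finset.card_le_card (Finset.monotone_filter_right _ fun j _ hj => (hplane j hj).1)
  by_cases hi : n i = 2
  · have hmem : i ∈ Finset.univ.filter fun i => n i = 2 := by simpa using hi
    rw [Finset.card_erase_of_mem hmem] at hsub
    have := Finset.card_pos.2 ⟨i, hmem⟩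
    obtain ⟨l, hl1, hl0⟩ := exists_dual_eq_one (hplane i hi).2
    have hlv : l (v i) = 0 := hl0 _ (Submodule.subset_span (by simp))
    have hla : l (a i) = 0 := hl0 _ (Submodule.subset_span (by simp))
    obtain ⟨f, hfa, hfb, hf1, hf2⟩ := exists_prodForm_direction hv hab ha hb i
      (w := w (b i) • l) (r := 1) (s := 2) (by simp [hlv]) (Or.inr ⟨rfl, by simp [hla]⟩)
      (Or.inl rfl) (by omega)
    obtain ⟨g, hga, hgb, hg1, hg2⟩ := exists_prodForm_direction hv hab ha hb i
      (w := w - w (b i) • l) (r := 2) (s := 1) (by simp [hlv, hw]) (Or.inl rfl)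
      (Or.inr ⟨rfl, by simp [hl1]⟩) (by omega)
    refine ⟨f + g, hfa.add hga, hfb.add hgb, fun x => ?_, fun m hm x => ?_⟩
    · simp [hf1, hg1]
    · simp [hf2 m hm, hg2 m hm]
  · rw [Finset.erase_eq_of_notMem (by simpa using hi)] at hsub
    exact exists_prodForm_direction hv hab ha hb i hw (Or.inl rfl) (Or.inl rfl) (by omega)

-- One product with value 1 at `p` adjusts the value; what is left is a sum of derivatives in single
-- factors, each supplied by `exists_form_direction`.
open Classical in
theorem exists_restrictPoint_eq {p : Point K n} {a b : ∀ i, Fin (n i + 1) → K}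
    (hab : ∀ i, (p i).rep ∉ Submodule.span K {a i} ∨ (p i).rep ∉ Submodule.span K {b i})
    (ha : 3 ≤ (Finset.univ.filter fun i => (p i).rep ∉ Submodule.span K {a i}).card)
    (hb : 3 ≤ (Finset.univ.filter fun i => (p i).rep ∉ Submodule.span K {b i}).card)
    (hplane : ∀ i, n i = 2 →
      (p i).rep ∉ Submodule.span K {a i, b i} ∧ b i ∉ Submodule.span K {(p i).rep, a i})
    (hk : 5 ≤ k + (Finset.univ.filter fun i => n i = 2).card) (x : jets p) :
    ∃ f : Form K n, restrictPoint p f = x ∧ SingularAt f a ∧ SingularAt f b := by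
  have hv : ∀ i, (p i).rep ≠ 0 := fun i => (p i).rep_nonzero
  have hWcard : (Finset.univ.filter fun i => n i = 2).card ≤
      (Finset.univ.filter fun i => (p i).rep ∉ Submodule.span K {a i, b i}).card :=
    Finset.card_le_card (Finset.monotone_filter_right _ fun j _ hj => (hplane j hj).1)
  obtain ⟨l, hl, hla, hlb⟩ := exists_dual_family hv Finset.univ (r := 2) (s := 2)
    (by omega) (by omega) hab (by rw [Finset.card_univ, Fintype.card_fin]; omega)
  set v : ∀ i, Fin (n i + 1) → K := fun i => (p i).rep with hvdef
  set f₀ := prodForm l with hf₀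
  have hf₀v : f₀ v = 1 := by
    rw [hf₀, prodForm_apply]
    exact Finset.prod_eq_one fun i _ => hl i
  -- The derivatives still missing after `x.1.1 • f₀`. By Euler's relation each `y i`, read as a
  -- linear form, vanishes at `v i`.
  set y : ∀ i, Fin (n i + 1) → K := fun i j =>
    x.1.2 i j - x.1.1 * f₀ (Function.update v i (Pi.single j 1)) with hy
  have hw : ∀ i, Fintype.linearCombination K (y i) (v i) = 0 := by
    intro i
    have h1 := x.2 i
    have h2 : ∑ j, v i j * f₀ (Function.update v i (Pi.single j 1)) = f₀ v :=
      (restrictPoint p f₀).2 i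
    rw [Fintype.linearCombination_apply]
    simp only [hy, smul_eq_mul, mul_sub, Finset.sum_sub_distrib, mul_left_comm _ x.1.1]
    rw [← Finset.mul_sum, h2, hf₀v, mul_one, sub_eq_zero]
    exact h1
  choose g hga hgb hg1 hg2 using fun i =>
    exists_form_direction hv hab ha hb hplane hk i (hw i)
  refine ⟨x.1.1 • f₀ + ∑ i, g i, restrictPoint_eq_iff.2 ⟨?_, fun i j => ?_⟩,
    ((singularAt_prodForm_of_card hla).smul _).add (SingularAt.sum fun i _ => hga i),
    ((singularAt_prodForm_of_card hlb).smul _).add (SingularAt.sum fun i _ => hgb i)⟩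
  · have : ∀ i, g i v = 0 := fun i => by
      have := hg1 i (v i)
      rwa [Function.update_eq_self, hw] at this
    change (x.1.1 • f₀ + ∑ i, g i) v = _
    simp [this, hf₀v]
  · change (x.1.1 • f₀ + ∑ i, g i) (Function.update v i (Pi.single j 1)) = _
    rw [add_apply, sum_apply, Finset.sum_eq_single i, hg1,
      Fintype.linearCombination_apply_single]
    · simp [hy]
    · intro m _ hm
      exact hg2 m i hm.symm _
    · simp

/-! ### Minimality in terms of representatives, and vanishing of the defect. -/

theorem rep_mem_span_rep_iff {V : Type*} [AddCommGroup V] [Module K V] {x y : ℙ K V} :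
    x.rep ∈ Submodule.span K {y.rep} ↔ x = y := by
  rw [Submodule.mem_span_singleton, ← Projectivization.mk_eq_mk_iff' K _ _ x.rep_nonzero
    y.rep_nonzero, Projectivization.mk_rep, Projectivization.mk_rep]

theorem linSpan_eq_span {V : Type*} [AddCommGroup V] [Module K V] (A : Set (ℙ K V)) :
    linSpan A = Submodule.span K (Projectivization.rep '' A) := by
  rw [linSpan, Submodule.span_eq_iSup_of_singleton_spans, iSup_image]
  simp only [Projectivization.submodule_eq]

theorem linSpan_image_triple (a b c : Point K n) (i : Fin k) :
    linSpan ((fun p : Point K n => p i) '' {a, b, c}) =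
      Submodule.span K {(a i).rep, (b i).rep, (c i).rep} := by
  rw [linSpan_eq_span]
  simp [Set.image_insert_eq]

theorem triple_rotate {α : Type*} (a b c : α) : ({b, c, a} : Set α) = {a, b, c} := by
  ext x
  simp only [Set.mem_insert_iff, Set.mem_singleton_iff]
  tauto

/-- Three points whose projections span a plane are linearly independent there. -/
theorem rep_notMem_span_of_plane {a b c : Point K n} (hS : IsMinimalFor {a, b, c}) {i : Fin k}
    (hi : n i = 2) : (c i).rep ∉ Submodule.span K {(a i).rep, (b i).rep} := by
  classical
  intro h
  have h1 := (hS i).2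
  rw [linSpan_image_triple] at h1
  have h2 : Submodule.span K {(a i).rep, (b i).rep} = ⊤ := by
    rw [← h1]
    refine le_antisymm (Submodule.span_mono fun x hx => ?_) (Submodule.span_le.2 ?_)
    · simp only [Set.mem_insert_iff, Set.mem_singleton_iff] at hx ⊢
      tauto
    · rintro x (rfl | rfl | rfl)
      · exact Submodule.subset_span (by simp)
      · exact Submodule.subset_span (by simp)
      · exact h
  have h3 := finrank_span_le_card (R := K) ({(a i).rep, (b i).rep} : Set (Fin (n i + 1) → K))
  rw [h2, finrank_top, Module.finrank_fin_fun] at h3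
  have h4 := Finset.card_le_two (a := (a i).rep) (b := (b i).rep)
  simp only [Set.toFinset_insert, Set.toFinset_singleton] at h3
  omega

open Classical in
/-- If three points span, are pairwise distinct in at least three factors, and there are enough
factors, the double points supported there impose independent conditions. -/
theorem defect_eq_zero {a b c : Point K n} (hS : IsMinimalFor {a, b, c})
    (hab : 3 ≤ (Finset.univ.filter fun i => ¬ a i = b i).card)
    (hbc : 3 ≤ (Finset.univ.filter fun i => ¬ b i = c i).card)
    (hca : 3 ≤ (Finset.univ.filter fun i => ¬ c i = a i).card)
    (hk : 5 ≤ k + (Finset.univ.filter fun i => n i = 2).card) :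
    defect ({a, b, c} : Set (Point K n)) = 0 := by
  classical
  have hk0 : 0 < k := by
    have := Finset.card_le_univ (Finset.univ.filter fun i => ¬ a i = b i)
    rw [Fintype.card_fin] at this
    omega
  -- Stated for all triples so that it can be applied to the three cyclic rotations of the points.
  have key : ∀ a b c : Point K n, IsMinimalFor {a, b, c} →
      3 ≤ (Finset.univ.filter fun i => ¬ a i = b i).card →
      3 ≤ (Finset.univ.filter fun i => ¬ c i = a i).card →
      ∀ x : jets a, ∃ f : Form K n, restrictPoint a f = x ∧
        (SingularAt f fun i => (b i).rep) ∧ SingularAt f fun i => (c i).rep := by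
    intro a b c hS hab hca
    refine exists_restrictPoint_eq ?_ ?_ ?_ ?_ hk
    · intro i
      rw [rep_mem_span_rep_iff, rep_mem_span_rep_iff]
      by_contra! h
      obtain ⟨x, hx, y, hy, hxy⟩ := (hS i).1
      simp only [Set.image_insert_eq, Set.image_singleton, ← h.1, ← h.2, Set.mem_insert_iff,
        Set.mem_singleton_iff, or_self] at hx hy
      exact hxy (hx.trans hy.symm)
    · simpa only [rep_mem_span_rep_iff] using hab
    · simpa only [rep_mem_span_rep_iff, eq_comm] using hca
    · intro i hi
      refine ⟨rep_notMem_span_of_plane (a := b) (b := c) (c := a) ?_ hi,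
        rep_notMem_span_of_plane hS hi⟩
      rwa [triple_rotate]
  refine (Nat.eq_zero_or_pos _).resolve_right fun hpos => ?_
  refine (defect_pos_iff (Set.toFinite _)).1 hpos (range_restrict_eq_top hk0 (Set.toFinite _) ?_)
  have hS' := hS
  rw [← triple_rotate] at hS'
  have hS'' := hS'
  rw [← triple_rotate] at hS''
  intro p hp x
  simp only [Set.mem_insert_iff, Set.mem_singleton_iff, forall_eq_or_imp, forall_eq] at hp ⊢
  rcases hp with rfl | rfl | rfl
  · obtain ⟨f, h1, h2, h3⟩ := key _ _ _ hS hab hca x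
    exact ⟨f, h1, fun h => absurd rfl h, fun _ => h2, fun _ => h3⟩
  · obtain ⟨f, h1, h2, h3⟩ := key _ _ _ hS' hbc hab x
    exact ⟨f, h1, fun _ => h3, fun h => absurd rfl h, fun _ => h2⟩
  · obtain ⟨f, h1, h2, h3⟩ := key _ _ _ hS'' hca hbc x
    exact ⟨f, h1, fun _ => h2, fun _ => h3, fun h => absurd rfl h⟩

/-! ### Spaces without nonzero singular forms. -/

theorem apply_eq_zero_of_span {f : Form K n} {x : ∀ i, Fin (n i + 1) → K} (i : Fin k)
    {T : Set (Fin (n i + 1) → K)} (hT : Submodule.span K T = ⊤)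
    (h : ∀ t ∈ T, f (Function.update x i t) = 0) : f x = 0 := by
  have h0 : f.toLinearMap x i = 0 := LinearMap.ext_on hT fun t ht => h t ht
  simpa using LinearMap.congr_fun h0 (x i)

theorem IsMinimalFor.span_eq_top {S : Set (Point K n)} (hS : IsMinimalFor S) (i : Fin k) :
    Submodule.span K ((fun p : Point K n => (p i).rep) '' S) = ⊤ := by
  rw [← (hS i).2, linSpan_eq_span, Set.image_image]

/-- Expanding slot 0 over the spanning points `p` leaves at most one slot that differs from `p`, and
there the singularity at `p` gives zero. -/
theorem eq_zero_of_le_two {S : Set (Point K n)} (hS : IsMinimalFor S) (hk0 : 0 < k) (hk : k ≤ 2)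
    {f : Form K n} (hf : ∀ p ∈ S, SingularAt f fun i => (p i).rep) : f = 0 := by
  refine MultilinearMap.ext fun x => apply_eq_zero_of_span ⟨0, hk0⟩ (hS.span_eq_top _) ?_
  rintro _ ⟨p, hp, rfl⟩
  obtain rfl | rfl : k = 1 ∨ k = 2 := by omega
  · rw [← (hf p hp).apply_self hk0]
    congr 1
    funext l
    obtain rfl := Subsingleton.elim l 0
    rfl
  · rw [← hf p hp 1 (x 1)]
    congr 1
    funext l
    fin_cases l <;> rfl

theorem finrank_span_rep_pair {V : Type*} [AddCommGroup V] [Module K V] {x y : ℙ K V}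
    (h : x ≠ y) : Module.finrank K (Submodule.span K {x.rep, y.rep}) = 2 := by
  have hli := Projectivization.linearIndependent_pair_iff_ne.2 h
  have := finrank_span_eq_card hli
  rwa [Matrix.range_cons_cons_empty, Fintype.card_fin] at this

theorem finrank_linSpan_pair {V : Type*} [AddCommGroup V] [Module K V] {x y : ℙ K V}
    (h : x ≠ y) : Module.finrank K (linSpan {x, y}) = 2 := by
  rw [linSpan_eq_span, Set.image_pair, finrank_span_rep_pair h]

theorem span_rep_pair_eq_top {m : ℕ} (hm : m = 1) {x y : ℙ K (Fin (m + 1) → K)} (h : x ≠ y) :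
    Submodule.span K {x.rep, y.rep} = ⊤ := by
  apply Submodule.eq_top_of_finrank_eq
  rw [finrank_span_rep_pair h, Module.finrank_fin_fun, hm]

/-- Slots `j` and `m` are expanded over the bases given by `a` and `b`. With `a` in slot `i`, every
resulting argument differs from `a` or from `b` in at most one slot. -/
theorem apply_update_eq_zero {f : Form K n} {i j m : Fin k} (hij : i ≠ j) (him : i ≠ m)
    (hjm : j ≠ m) (hcover : ∀ l, l = i ∨ l = j ∨ l = m) (hj : n j = 1) (hm : n m = 1)
    {a b : Point K n} (ha : SingularAt f fun i => (a i).rep)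
    (hb : SingularAt f fun i => (b i).rep) (habj : a j ≠ b j) (habm : a m ≠ b m)
    (x : ∀ i, Fin (n i + 1) → K) : f (Function.update x i (a i).rep) = 0 := by
  refine apply_eq_zero_of_span j (span_rep_pair_eq_top hj habj) ?_
  rintro _ (rfl | rfl)
  · rw [← ha m (x m)]
    congr 1
    funext l
    rcases hcover l with rfl | rfl | rfl <;>
      simp [hij, him, hjm, him.symm, hjm.symm]
  · refine apply_eq_zero_of_span m (span_rep_pair_eq_top hm habm) ?_
    rintro _ (rfl | rfl)
    · rw [← ha j (b j).rep]
      congr 1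
      funext l
      rcases hcover l with rfl | rfl | rfl <;> simp [hij, him, hjm, hjm.symm]
    · rw [← hb i (a i).rep]
      congr 1
      funext l
      rcases hcover l with rfl | rfl | rfl <;> simp [hij, him, hjm, hij.symm, him.symm]

theorem eq_zero_of_two_lines {a b c : Point K n} (hS : IsMinimalFor {a, b, c}) {f : Form K n}
    (hf : ∀ p ∈ ({a, b, c} : Set (Point K n)), SingularAt f fun i => (p i).rep)
    {i j m : Fin k} (hij : i ≠ j) (him : i ≠ m) (hjm : j ≠ m)
    (hcover : ∀ l, l = i ∨ l = j ∨ l = m) (hj : n j = 1) (hm : n m = 1)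
    (hab : ∀ l, a l ≠ b l) (hca : ∀ l, c l ≠ a l) : f = 0 := by
  have ha := hf a (by simp)
  have hb := hf b (by simp)
  have hc := hf c (by simp)
  refine MultilinearMap.ext fun x => apply_eq_zero_of_span i (hS.span_eq_top i) ?_
  rintro _ ⟨p, rfl | rfl | rfl, rfl⟩
  · exact apply_update_eq_zero hij him hjm hcover hj hm ha hb (hab j) (hab m) x
  · exact apply_update_eq_zero hij him hjm hcover hj hm hb ha (hab j).symm (hab m).symm x
  · exact apply_update_eq_zero hij him hjm hcover hj hm hc ha (hca j) (hca m) x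

/-! ### Classification. -/

theorem IsMinimalFor.eq_one_or_two {S : Set (Point K n)} (hS : IsMinimalFor S)
    (h3 : S.ncard = 3) (i : Fin k) : n i = 1 ∨ n i = 2 := by
  classical
  have hfin : S.Finite := Set.finite_of_ncard_ne_zero (by omega)
  have := hfin.fintype
  have h1 : n i ≠ 0 := by
    intro h0
    obtain ⟨x, -, y, -, hxy⟩ := (hS i).1
    refine hxy (rep_mem_span_rep_iff.1 ?_)
    rw [(Submodule.eq_top_of_finrank_eq (S := Submodule.span K {y.rep}) ?_)]
    · trivial
    · rw [finrank_span_singleton y.rep_nonzero, Module.finrank_fin_fun, h0]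
  have h2 := hS.span_eq_top i
  have h4 := finrank_span_le_card (R := K) ((fun p : Point K n => (p i).rep) '' S)
  rw [h2, finrank_top, Module.finrank_fin_fun, ← Set.ncard_eq_toFinset_card'] at h4
  have := Set.ncard_image_le (f := fun p : Point K n => (p i).rep) hfin
  omega

theorem ne_of_eq_of_isMinimalFor {a b c : Point K n} (hS : IsMinimalFor {a, b, c}) {i : Fin k}
    (h : a i = b i) : a i ≠ c i := by
  intro h'
  obtain ⟨x, hx, y, hy, hxy⟩ := (hS i).1
  simp only [Set.image_insert_eq, Set.image_singleton, ← h, ← h', Set.mem_insert_iff,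
    Set.mem_singleton_iff, or_self] at hx hy
  exact hxy (hx.trans hy.symm)

theorem ne_of_plane {a b c : Point K n} (hS : IsMinimalFor {a, b, c}) {i : Fin k}
    (hi : n i = 2) : a i ≠ b i := by
  intro h
  rw [← triple_rotate, ← triple_rotate] at hS
  have := rep_notMem_span_of_plane hS hi
  rw [h] at this
  exact this (Submodule.subset_span (by simp))

-- The two families record one or two differing factors. Where `a` and `b` agree, minimality forces
-- the factor to be a line and `c` to differ from them.
open Classical in
theorem isExample_of_card_le_two {a b c : Point K n} (hS : IsMinimalFor {a, b, c}) (hk : 3 ≤ k)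
    (hn : ∀ i, n i = 1 ∨ n i = 2) (hab : a ≠ b)
    (hcard : (Finset.univ.filter fun i => ¬ a i = b i).card < 3) :
    IsFirstExample ({a, b, c} : Set (Point K n)) ∨
      IsSecondExample ({a, b, c} : Set (Point K n)) := by
  have hone : ∀ i, a i = b i → n i = 1 := fun i h =>
    (hn i).resolve_right fun h' => ne_of_plane hS h' h
  have hpos : 0 < (Finset.univ.filter fun i => ¬ a i = b i).card := by
    obtain ⟨i, hi⟩ := Function.ne_iff.1 hab
    exact Finset.card_pos.2 ⟨i, by simpa using hi⟩
  obtain h1 | h2 : (Finset.univ.filter fun i => ¬ a i = b i).card = 1 ∨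
      (Finset.univ.filter fun i => ¬ a i = b i).card = 2 := by omega
  · left
    obtain ⟨i₀, hi₀⟩ := Finset.card_eq_one.1 h1
    simp only [Finset.ext_iff, Finset.mem_filter, Finset.mem_univ, true_and,
      Finset.mem_singleton] at hi₀
    have heq : ∀ i, i ≠ i₀ → a i = b i := fun i hi => not_not.1 (mt (hi₀ i).1 hi)
    refine ⟨hk, i₀, hn i₀, fun i hi => hone i (heq i hi), a, b, c, rfl, (hi₀ i₀).2 rfl,
      fun i hi => ⟨heq i hi, ne_of_eq_of_isMinimalFor hS (heq i hi)⟩, fun h => ?_⟩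
    rw [(hS i₀).2, finrank_top, Module.finrank_fin_fun, h]
  · right
    obtain ⟨i₁, i₂, hne, hi₀⟩ := Finset.card_eq_two.1 h2
    simp only [Finset.ext_iff, Finset.mem_filter, Finset.mem_univ, true_and,
      Finset.mem_singleton, Finset.mem_insert] at hi₀
    have heq : ∀ i, i ≠ i₁ → i ≠ i₂ → a i = b i := fun i hi hi' =>
      not_not.1 (mt (hi₀ i).1 (by tauto))
    refine ⟨hk, i₁, i₂, hne, c, a, b, triple_rotate c a b, fun j hj => ⟨hn j,
      finrank_linSpan_pair ((hi₀ j).2 hj), fun h hle => ?_⟩, fun j hj hj' =>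
      ⟨hone j (heq j hj hj'), heq j hj hj', (ne_of_eq_of_isMinimalFor hS (heq j hj hj')).symm⟩⟩
    rw [linSpan_eq_span, Set.image_pair, Projectivization.submodule_eq,
      Submodule.span_singleton_le_iff_mem] at hle
    exact rep_notMem_span_of_plane hS h hle

open Classical in
theorem card_planes_le_card_ne {a b c : Point K n} (hS : IsMinimalFor {a, b, c}) :
    (Finset.univ.filter fun i => n i = 2).card ≤
      (Finset.univ.filter fun i => ¬ a i = b i).card :=
  Finset.card_le_card (Finset.monotone_filter_right _ fun _ _ h => ne_of_plane hS h)

theorem isMinimalFor_rotate {a b c : Point K n} (hS : IsMinimalFor {a, b, c}) :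
    IsMinimalFor {b, c, a} := by
  rwa [triple_rotate]

theorem defect_eq_zero_of_three_planes {a b c : Point K n} (hS : IsMinimalFor {a, b, c})
    (h : 3 ≤ (Finset.univ.filter fun i => n i = 2).card) :
    defect ({a, b, c} : Set (Point K n)) = 0 := by
  have hk := Finset.card_le_univ (Finset.univ.filter fun i => n i = 2)
  rw [Fintype.card_fin] at hk
  have h1 := isMinimalFor_rotate hS
  have h2 := isMinimalFor_rotate h1
  exact defect_eq_zero hS (h.trans (card_planes_le_card_ne hS)) (h.trans (card_planes_le_card_ne h1))
    (h.trans (card_planes_le_card_ne h2)) (by omega)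

theorem classification {a b c : Point K n} (hS : IsMinimalFor {a, b, c}) (hk : 1 ≤ k)
    (hn : ∀ i, n i = 1 ∨ n i = 2) (hab : a ≠ b) (hbc : b ≠ c) (hca : c ≠ a)
    (h0 : 0 < h0 ({a, b, c} : Set (Point K n))) (hd : 0 < defect ({a, b, c} : Set (Point K n))) :
    IsFirstExample ({a, b, c} : Set (Point K n)) ∨
      IsSecondExample ({a, b, c} : Set (Point K n)) ∨ (k = 4 ∧ ∀ i, n i = 1) := by
  classical
  obtain ⟨f, hf0, hf⟩ := (h0_pos_iff hk).1 h0
  have hk3 : 3 ≤ k := by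
    by_contra hlt
    exact hf0 (eq_zero_of_le_two hS hk (by omega) hf)
  have h1 := isMinimalFor_rotate hS
  have h2 := isMinimalFor_rotate h1
  rw [← or_assoc]
  by_cases dab : (Finset.univ.filter fun i => ¬ a i = b i).card < 3
  · exact Or.inl (isExample_of_card_le_two hS hk3 hn hab dab)
  by_cases dbc : (Finset.univ.filter fun i => ¬ b i = c i).card < 3
  · left
    rw [← triple_rotate]
    exact isExample_of_card_le_two h1 hk3 hn hbc dbc
  by_cases dca : (Finset.univ.filter fun i => ¬ c i = a i).card < 3
  · left
    rw [← triple_rotate, ← triple_rotate]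
    exact isExample_of_card_le_two h2 hk3 hn hca dca
  right
  have hlt : k + (Finset.univ.filter fun i => n i = 2).card < 5 := by
    by_contra hge
    rw [defect_eq_zero hS (by omega) (by omega) (by omega) (by omega)] at hd
    exact lt_irrefl _ hd
  obtain rfl | rfl : k = 4 ∨ k = 3 := by omega
  · refine ⟨rfl, fun i => (hn i).resolve_right fun hi => ?_⟩
    have := Finset.card_pos.2 ⟨i, show i ∈ Finset.univ.filter fun i => n i = 2 by simpa using hi⟩
    omega
  · exfalso
    -- For `k = 3`, differing in at least three factors means differing in all of them.
    have hall : ∀ (P : Fin 3 → Prop) [DecidablePred P],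
        ¬ (Finset.univ.filter P).card < 3 → ∀ i, P i := by
      intro P _ hP i
      have : Finset.univ.filter P = Finset.univ := by
        apply Finset.eq_univ_of_card
        have := Finset.card_le_univ (Finset.univ.filter P)
        rw [Fintype.card_fin] at *
        omega
      exact (Finset.mem_filter.1 (this.symm ▸ Finset.mem_univ i)).2
    have hdab := hall _ dab
    have hdca := hall _ dca
    have hplane : ∀ i j, i ≠ j → n i = 1 ∨ n j = 1 := by
      intro i j hij
      by_contra! h
      have : 1 < (Finset.univ.filter fun i => n i = 2).card :=
        Finset.one_lt_card.2 ⟨i, by simpa using (hn i).resolve_left h.1, j,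
          by simpa using (hn j).resolve_left h.2, hij⟩
      omega
    have hperm : ∀ i j m : Fin 3, i ≠ j → i ≠ m → j ≠ m → n j = 1 → n m = 1 → False :=
      fun i j m hij him hjm hj hm =>
        hf0 (eq_zero_of_two_lines hS hf hij him hjm (by omega) hj hm hdab hdca)
    have h01 := hplane 0 1 (by decide)
    have h02 := hplane 0 2 (by decide)
    have h12 := hplane 1 2 (by decide)
    have p0 := hperm 0 1 2 (by decide) (by decide) (by decide)
    have p1 := hperm 1 0 2 (by decide) (by decide) (by decide)
    have p2 := hperm 2 0 1 (by decide) (by decide) (by decide)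
    tauto

/-! ### Coordinate points and nonemptiness. -/

variable (K) in
/-- The point whose projections are the coordinate points with indices `e i`. -/
noncomputable def coordPoint (e : ∀ i, Fin (n i + 1)) : Point K n := fun i =>
  Projectivization.mk K (Pi.single (e i) 1) (by simp)

theorem exists_rep_coordPoint (e : ∀ i, Fin (n i + 1)) (i : Fin k) :
    ∃ c : K, c ≠ 0 ∧ (coordPoint K e i).rep = c • Pi.single (e i) 1 := by
  obtain ⟨a, ha⟩ := Projectivization.exists_smul_eq_mk_rep K
    (Pi.single (e i) 1 : Fin (n i + 1) → K) (by simp)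
  exact ⟨a, a.ne_zero, ha.symm⟩

theorem coordPoint_apply_ne {e e' : ∀ i, Fin (n i + 1)} {i : Fin k} (h : e i ≠ e' i) :
    coordPoint K e i ≠ coordPoint K e' i := by
  intro h'
  obtain ⟨a, ha⟩ := (Projectivization.mk_eq_mk_iff' K _ _ _ _).1 h'
  have := congrFun ha (e i)
  simp [h] at this

theorem singularAt_coordPoint {d e : ∀ i, Fin (n i + 1)} {i j : Fin k} (hij : i ≠ j)
    (hi : e i ≠ d i) (hj : e j ≠ d j) :
    SingularAt (prodForm fun i => LinearMap.proj (R := K) (φ := fun _ => K) (d i))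
      fun i => (coordPoint K e i).rep := by
  obtain ⟨a, -, ha⟩ := exists_rep_coordPoint (K := K) e i
  obtain ⟨b, -, hb⟩ := exists_rep_coordPoint (K := K) e j
  refine singularAt_prodForm hij ?_ ?_
  · simp [ha, hi.symm]
  · simp [hb, hj.symm]

/-- A partial derivative at a coordinate point is a nonzero multiple of one coefficient of `f`. The
multiple depends on the chosen representatives, the coefficient does not, so jets at different
points can be compared. -/
theorem exists_apply_update_coordPoint (f : Form K n) (e : ∀ i, Fin (n i + 1)) (i : Fin k)
    (j : Fin (n i + 1)) : ∃ c : K, c ≠ 0 ∧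
      f (Function.update (fun l => (coordPoint K e l).rep) i (Pi.single j 1)) =
        c * f fun l => Pi.single (Function.update e i j l) 1 := by
  classical
  choose c hc hc' using exists_rep_coordPoint (K := K) e
  refine ⟨∏ l, Function.update c i 1 l, Finset.prod_ne_zero_iff.2 fun l _ => ?_, ?_⟩
  · by_cases h : l = i
    · subst h; simp
    · simp [h, hc]
  · rw [← smul_eq_mul, ← f.map_smul_univ]
    congr 1
    funext l
    by_cases h : l = i
    · subst h; simp
    · simp [h, hc']

theorem eq_zero_or_eq_last {m : ℕ} (hm : m = 1) (j : Fin (m + 1)) : j = 0 ∨ j = Fin.last m := by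
  subst hm
  fin_cases j <;> simp

theorem eq_zero_or_one_or_last {m : ℕ} (hm : m = 2) (j : Fin (m + 1)) :
    j = 0 ∨ j = 1 ∨ j = Fin.last m := by
  subst hm
  fin_cases j <;> simp

theorem isMinimalFor_coordPoints {e₁ e₂ e₃ : ∀ i, Fin (n i + 1)} (hn : ∀ i, n i ≠ 0)
    (h : ∀ i j, j = e₁ i ∨ j = e₂ i ∨ j = e₃ i) :
    IsMinimalFor ({coordPoint K e₁, coordPoint K e₂, coordPoint K e₃} : Set (Point K n)) := by
  intro i
  have hmem : ∀ j, ∃ p ∈ ({coordPoint K e₁, coordPoint K e₂, coordPoint K e₃} : Set (Point K n)),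
      p i = Projectivization.mk K (Pi.single j 1) (by simp) := by
    intro j
    rcases h i j with rfl | rfl | rfl
    · exact ⟨coordPoint K e₁, by simp, rfl⟩
    · exact ⟨coordPoint K e₂, by simp, rfl⟩
    · exact ⟨coordPoint K e₃, by simp, rfl⟩
  constructor
  · obtain ⟨p, hp, hp'⟩ := hmem 0
    obtain ⟨q, hq, hq'⟩ := hmem (Fin.last _)
    refine ⟨p i, ⟨p, hp, rfl⟩, q i, ⟨q, hq, rfl⟩, fun hpq => ?_⟩
    rw [hp', hq', Projectivization.mk_eq_mk_iff'] at hpq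
    obtain ⟨a, ha⟩ := hpq
    have := congrFun ha 0
    simp [(hn i).symm, Fin.ext_iff] at this
  · rw [eq_top_iff, ← (Pi.basisFun K (Fin (n i + 1))).span_eq, Submodule.span_le]
    rintro _ ⟨j, rfl⟩
    obtain ⟨p, hp, hp'⟩ := hmem j
    refine (le_biSup Projectivization.submodule (Set.mem_image_of_mem _ hp) :
      (p i).submodule ≤ linSpan _) ?_
    rw [hp', Projectivization.submodule_mk, Pi.basisFun_apply]
    exact Submodule.mem_span_singleton_self _

theorem terracini_nonempty (hk : 3 ≤ k) (hn : ∀ i, n i = 1 ∨ n i = 2) {i₁ i₂ : Fin k}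
    (hne : i₁ ≠ i₂) (hplanes : ∀ i, n i = 2 → i = i₁ ∨ i = i₂) :
    (terracini K n 3).Nonempty := by
  classical
  obtain ⟨i₃, h31, h32⟩ : ∃ i₃ : Fin k, i₃ ≠ i₁ ∧ i₃ ≠ i₂ := by
    obtain ⟨i, hi⟩ := Finset.exists_mem_notMem_of_card_lt_card
      (s := {i₁, i₂}) (t := (Finset.univ : Finset (Fin k)))
      (by rw [Finset.card_univ, Fintype.card_fin]; exact Finset.card_le_two.trans_lt (by omega))
    exact ⟨i, by simpa using hi⟩
  have hn0 : ∀ i, n i ≠ 0 := fun i => by have := hn i; omega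
  have h10 : ∀ i, (1 : Fin (n i + 1)) ≠ 0 := fun i => by simpa using hn0 i
  have hl0 : ∀ i, Fin.last (n i) ≠ 0 := fun i => by simpa [Fin.ext_iff] using hn0 i
  set eu : ∀ i, Fin (n i + 1) := fun i => if i = i₂ then 1 else 0 with heu
  set ev : ∀ i, Fin (n i + 1) := fun i => if i = i₁ then 1 else 0 with hev
  set eo : ∀ i, Fin (n i + 1) := fun i => Fin.last (n i) with heo
  set d : ∀ i, Fin (n i + 1) := fun i => if i = i₁ ∨ i = i₂ then 0 else 1 with hd
  set u := coordPoint K eu with hu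
  set v := coordPoint K ev with hv
  set o := coordPoint K eo with ho
  have huv : u ≠ v := fun h => coordPoint_apply_ne (K := K) (e := eu) (e' := ev) (i := i₂)
    (by simp [heu, hev, hne.symm, hn0]) (congrFun h i₂)
  have huo : u ≠ o := fun h => coordPoint_apply_ne (K := K) (e := eu) (e' := eo) (i := i₃)
    (by simp only [heu, heo, if_neg h32]; exact (hl0 _).symm) (congrFun h i₃)
  have hvo : v ≠ o := fun h => coordPoint_apply_ne (K := K) (e := ev) (e' := eo) (i := i₃)
    (by simp only [hev, heo, if_neg h31]; exact (hl0 _).symm) (congrFun h i₃)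
  refine ⟨{u, v, o}, ⟨Set.ncard_eq_three.2 ⟨u, v, o, huv, huo, hvo, rfl⟩, Set.toFinite _, ?_, ?_⟩,
    isMinimalFor_coordPoints hn0 fun i j => ?_⟩
  · refine (h0_pos_iff (by omega)).2
      ⟨prodForm fun i => LinearMap.proj (R := K) (φ := fun _ => K) (d i), fun h => ?_, ?_⟩
    · have := congrArg (fun g => g fun i => Pi.single (d i) (1 : K)) h
      simp [prodForm_apply] at this
    · rintro _ (rfl | rfl | rfl)
      · exact singularAt_coordPoint h32 (by simp [heu, hd, h31, h32, hn0]) (by simp [heu, hd, hn0])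
      · exact singularAt_coordPoint h31 (by simp [hev, hd, h31, h32, hn0]) (by simp [hev, hd, hn0])
      · exact singularAt_coordPoint hne (by simpa [heo, hd] using hl0 i₁)
          (by simpa [heo, hd] using hl0 i₂)
  · rw [defect_pos_iff (Set.toFinite _), Ne, LinearMap.range_eq_top]
    intro hsurj
    -- Euler's relation allows this jet because coordinate 1 of `u` vanishes in factor `i₁`.
    have hjet : (0, Pi.single i₁ (Pi.single 1 1)) ∈ jets u := by
      intro i
      obtain ⟨c, -, hc⟩ := exists_rep_coordPoint (K := K) eu i
      by_cases hi : i = i₁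
      · subst hi
        have hci : (u i).rep 1 = 0 := by
          rw [hu, hc]
          simp [heu, hne, h10]
        simpa [Pi.single_apply] using hci
      · simp [hi]
    obtain ⟨f, hf⟩ := hsurj (Pi.single ⟨u, by simp⟩ ⟨_, hjet⟩)
    have hfu := (restrictPoint_eq_iff.1 ((congrFun hf ⟨u, by simp⟩).trans
      (Pi.single_eq_same _ _))).2 i₁ 1
    have hfv := (restrictPoint_eq_iff.1 ((congrFun hf ⟨v, by simp⟩).trans
      (Pi.single_eq_of_ne (fun h => huv (congrArg Subtype.val h).symm) _))).2 i₂ 1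
    obtain ⟨c, -, h1⟩ := exists_apply_update_coordPoint f eu i₁ 1
    obtain ⟨c', hc', h2⟩ := exists_apply_update_coordPoint f ev i₂ 1
    -- The obstruction: the same coefficient of `f` governs a derivative at `u`, prescribed to be 1,
    -- and a derivative at `v`, prescribed to be 0.
    have hsame : Function.update eu i₁ 1 = Function.update ev i₂ 1 := by
      funext l
      by_cases hl1 : l = i₁
      · subst hl1
        simp [hev, hne]
      · by_cases hl2 : l = i₂
        · subst hl2
          simp [heu, hl1]
        · simp [heu, hev, hl1, hl2]
    have h0 := (mul_eq_zero.1 (h2.symm.trans hfv)).resolve_left hc'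
    rw [hsame, h0, mul_zero] at h1
    simpa using h1.symm.trans hfu
  · by_cases hi1 : i = i₁
    · subst hi1
      have := (hn i).imp (fun h => eq_zero_or_eq_last h j) fun h => eq_zero_or_one_or_last h j
      simp only [heu, hev, heo, if_neg hne, if_true]
      tauto
    · by_cases hi2 : i = i₂
      · subst hi2
        have := (hn i).imp (fun h => eq_zero_or_eq_last h j) fun h => eq_zero_or_one_or_last h j
        simp only [heu, hev, heo, if_neg hne.symm, if_true]
        tauto
      · have := eq_zero_or_eq_last ((hn i).resolve_right fun h => by have := hplanes i h; tauto) j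
        simp only [heu, hev, heo, if_neg hi1, if_neg hi2]
        tauto

end

/-! ### Dimension bounds for forms and jets. -/

section Dimension

variable {K : Type*} [Field K] {k : ℕ} {n : Fin k → ℕ}

theorem finrank_form_le : Module.finrank K (Form K n) ≤ ∏ i, (n i + 1) := by
  classical
  let ev : Form K n →ₗ[K] ((∀ i, Fin (n i + 1)) → K) :=
    { toFun := fun f e => f fun i => Pi.single (e i) 1
      map_add' := fun f g => rfl
      map_smul' := fun c f => rfl }
  have hinj : Function.Injective ev := by
    intro f g h
    refine Module.Basis.ext_multilinear (fun i => Pi.basisFun K (Fin (n i + 1))) fun e => ?_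
    simp only [Pi.basisFun_apply]
    exact congrFun h e
  refine (LinearMap.finrank_le_finrank_of_injective hinj).trans_eq ?_
  rw [Module.finrank_fintype_fun_eq_card, Fintype.card_pi]
  simp

/-- The jets are the kernel of `k` Euler equations. A lower bound is enough for the later count. -/
theorem le_finrank_jets (p : Point K n) :
    1 + ∑ i, (n i + 1) ≤ Module.finrank K (jets p) + k := by
  let φ : (K × (∀ i : Fin k, Fin (n i + 1) → K)) →ₗ[K] (Fin k → K) :=
    LinearMap.pi fun i =>
      (Fintype.linearCombination K (p i).rep ∘ₗ LinearMap.proj i) ∘ₗ LinearMap.snd K K _ -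
        LinearMap.fst K K _
  have hker : LinearMap.ker φ = jets p := by
    ext x
    rw [LinearMap.mem_ker, funext_iff]
    refine forall_congr' fun i => ?_
    simp [φ, Fintype.linearCombination_apply, sub_eq_zero, mul_comm]
  have h1 := φ.finrank_range_add_finrank_ker
  have h2 := Submodule.finrank_le (LinearMap.range φ)
  rw [Module.finrank_fin_fun] at h2
  rw [hker, Module.finrank_prod, Module.finrank_self, Module.finrank_pi_fintype] at h1
  simp only [Module.finrank_fin_fun] at h1
  omega

end Dimension

/-! ### Quadrilinear forms on a plane singular at three points. -/

section Pencil

variable {K V : Type*} [Field K] [AddCommGroup V] [Module K V]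

/-- The product of two bilinear forms, in the first two and the last two variables. -/
def pairForm (q q' : V →ₗ[K] V →ₗ[K] K) : MultilinearMap K (fun _ : Fin 4 => V) K :=
  MultilinearMap.mk' (fun x => q (x 0) (x 1) * q' (x 2) (x 3))
    (fun x i y z => by fin_cases i <;> simp [add_mul, mul_add])
    (fun x i c z => by fin_cases i <;> simp [mul_assoc, mul_left_comm])

/-- The product of two bilinear forms, in the variables selected by a permutation. -/
def permPairForm (σ : Equiv.Perm (Fin 4)) (q q' : V →ₗ[K] V →ₗ[K] K) :
    MultilinearMap K (fun _ : Fin 4 => V) K :=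
  (pairForm q q').domDomCongr σ

theorem permPairForm_apply (σ : Equiv.Perm (Fin 4)) (q q' : V →ₗ[K] V →ₗ[K] K) (x : Fin 4 → V) :
    permPairForm σ q q' x = q (x (σ 0)) (x (σ 1)) * q' (x (σ 2)) (x (σ 3)) := rfl

/-- Changing one slot affects only one of the two bilinear factors, and the other still vanishes. -/
theorem permPairForm_update_eq_zero {σ : Equiv.Perm (Fin 4)} {q q' : V →ₗ[K] V →ₗ[K] K}
    {x : Fin 4 → V} (h : q (x (σ 0)) (x (σ 1)) = 0) (h' : q' (x (σ 2)) (x (σ 3)) = 0)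
    (i : Fin 4) (y : V) : permPairForm σ q q' (Function.update x i y) = 0 := by
  obtain ⟨m, rfl⟩ := σ.surjective i
  rw [permPairForm_apply]
  fin_cases m <;> simp [h, h']

/-- Three linear conditions on a space of dimension 4. -/
theorem exists_bilinear_ne_zero (hV : Module.finrank K V = 2) (x y : Fin 3 → V) :
    ∃ q : V →ₗ[K] V →ₗ[K] K, q ≠ 0 ∧ ∀ t, q (x t) (y t) = 0 := by
  have : Module.Finite K V := Module.finite_of_finrank_eq_succ hV
  let φ : (V →ₗ[K] V →ₗ[K] K) →ₗ[K] (Fin 3 → K) :=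
    { toFun := fun q t => q (x t) (y t)
      map_add' := fun f g => rfl
      map_smul' := fun c f => rfl }
  have hφ : LinearMap.ker φ ≠ ⊥ := by
    refine LinearMap.ker_ne_bot_of_finrank_lt 
      (K := K) (V := V →ₗ[K] V →ₗ[K] K) (V₂ := Fin 3 → K) (f := φ) ?_
    rw [Module.finrank_linearMap, Module.finrank_linearMap, hV, Module.finrank_self,
      Module.finrank_fin_fun]
    norm_num
  obtain ⟨q, hq, hq0⟩ := (Submodule.ne_bot_iff _).1 hφ
  exact ⟨q, hq0, congrFun (LinearMap.mem_ker.1 hq)⟩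

theorem exists_perm_apply_eq {α : Type*} [DecidableEq α] {p q i j : α} (hpq : p ≠ q)
    (hij : i ≠ j) : ∃ σ : Equiv.Perm α, σ p = i ∧ σ q = j := by
  refine ⟨Equiv.swap p i * Equiv.swap q (Equiv.swap p i j), ?_, ?_⟩
  · rw [Equiv.Perm.mul_apply, Equiv.swap_apply_of_ne_of_ne hpq, Equiv.swap_apply_left]
    intro h
    rw [eq_comm, Equiv.swap_apply_eq_iff, Equiv.swap_apply_left] at h
    exact hij h.symm
  · simp

theorem permPairForm_ne_zero {σ : Equiv.Perm (Fin 4)} {q q' : V →ₗ[K] V →ₗ[K] K} (h : q ≠ 0)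
    (h' : q' ≠ 0) : permPairForm σ q q' ≠ 0 := by
  obtain ⟨y₀, h⟩ := DFunLike.ne_iff.1 h
  obtain ⟨y₁, h⟩ := DFunLike.ne_iff.1 h
  obtain ⟨y₂, h'⟩ := DFunLike.ne_iff.1 h'
  obtain ⟨y₃, h'⟩ := DFunLike.ne_iff.1 h'
  refine DFunLike.ne_iff.2 ⟨fun l => ![y₀, y₁, y₂, y₃] (σ.symm l), ?_⟩
  simp only [permPairForm_apply, Equiv.symm_apply_apply]
  exact mul_ne_zero h h'

/-- The quadrilinear forms on a plane that are singular at three given points are not all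
proportional. -/
theorem not_forall_proportional (hV : Module.finrank K V = 2) (v : Fin 3 → Fin 4 → V)
    (F : MultilinearMap K (fun _ : Fin 4 => V) K)
    (H : ∀ g : MultilinearMap K (fun _ : Fin 4 => V) K,
      (∀ t i y, g (Function.update (v t) i y) = 0) → ∃ c : K, c • F = g) : False := by
  choose q hq0 hq using fun i j : Fin 4 =>
    exists_bilinear_ne_zero hV (fun t => v t i) fun t => v t j
  -- The nonzero products of bilinear forms are all singular at the points, so `F` splits as such a
  -- product for every pairing of the slots.
  have hF : ∀ σ : Equiv.Perm (Fin 4), ∃ d : K, ∀ y,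
      F y = d * (q (σ 0) (σ 1) (y (σ 0)) (y (σ 1)) * q (σ 2) (σ 3) (y (σ 2)) (y (σ 3))) := by
    intro σ
    obtain ⟨c, hc⟩ := H (permPairForm σ (q (σ 0) (σ 1)) (q (σ 2) (σ 3))) fun t =>
      permPairForm_update_eq_zero (hq _ _ t) (hq _ _ t)
    have hc0 : c ≠ 0 := by
      rintro rfl
      rw [zero_smul] at hc
      exact permPairForm_ne_zero (hq0 _ _) (hq0 _ _) hc.symm
    refine ⟨c⁻¹, fun y => ?_⟩
    rw [← permPairForm_apply, ← hc, smul_apply, smul_eq_mul,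
      inv_mul_cancel_left₀ hc0]
  obtain ⟨x, hx⟩ : ∃ x, F x ≠ 0 := by
    by_contra! h
    have h0 : F = 0 := MultilinearMap.ext h
    obtain ⟨c, hc⟩ := H (permPairForm 1 (q 0 1) (q 2 3)) fun t =>
      permPairForm_update_eq_zero (hq _ _ t) (hq _ _ t)
    rw [h0, smul_zero] at hc
    exact permPairForm_ne_zero (hq0 _ _) (hq0 _ _) hc.symm
  -- A pairing that separates `i` from `j` shows that their contributions to `F` multiply.
  have hmul : ∀ i j, i ≠ j → ∀ y z, F (Function.update (Function.update x i y) j z) * F x =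
      F (Function.update x i y) * F (Function.update x j z) := by
    intro i j hij y z
    obtain ⟨σ, rfl, rfl⟩ := exists_perm_apply_eq (p := (0 : Fin 4)) (q := 2) (by decide) hij
    obtain ⟨d, hd⟩ := hF σ
    simp only [hd]
    simp
    ring
  -- A pairing that joins `i` and `j` makes the bilinear factor vanish at the point `v t`.
  have hzero : ∀ t i j, i ≠ j →
      F (Function.update x i (v t i)) * F (Function.update x j (v t j)) = 0 := by
    intro t i j hij
    rw [← hmul i j hij]
    obtain ⟨σ, rfl, rfl⟩ := exists_perm_apply_eq (p := (0 : Fin 4)) (q := 1) (by decide) hij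
    obtain ⟨d, hd⟩ := hF σ
    rw [hd]
    simp [hq]
  -- By `hzero`, each of the three points has at most one slot with nonzero contribution. There are
  -- four slots, so one of them vanishes at all three points.
  obtain ⟨i, hi⟩ : ∃ i, ∀ t, F (Function.update x i (v t i)) = 0 := by
    by_contra! h
    choose τ hτ using h
    obtain ⟨i, j, hij, he⟩ := Fintype.exists_ne_map_eq_of_card_lt τ (by simp)
    have := hzero (τ i) i j hij
    rcases mul_eq_zero.1 this with h | h
    · exact hτ i h
    · rw [he] at h
      exact hτ j h
  obtain ⟨j, hij⟩ := exists_ne i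
  obtain ⟨σ, rfl, rfl⟩ := exists_perm_apply_eq (p := (0 : Fin 4)) (q := 1) (by decide) hij.symm
  have : Module.Finite K V := Module.finite_of_finrank_eq_succ hV
  let B := Module.finBasisOfFinrankEq K V hV
  -- The linear form from slot `i` vanishes at all three points, so the linear form in slot `j` is
  -- arbitrary. Taking both coordinates there gives two non-proportional singular forms.
  have hG : ∀ s : Fin 2, ∃ c : K, ∀ y, c * F y =
      F (Function.update x (σ 0) (y (σ 0))) * B.coord s (y (σ 1)) *
        q (σ 2) (σ 3) (y (σ 2)) (y (σ 3)) := by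
    intro s
    obtain ⟨c, hc⟩ := H (permPairForm σ ((F.toLinearMap x (σ 0)).smulRight (B.coord s))
      (q (σ 2) (σ 3))) fun t => permPairForm_update_eq_zero (by simp [hi]) (hq _ _ t)
    refine ⟨c, fun y => ?_⟩
    rw [← smul_eq_mul, ← smul_apply, hc]
    rfl
  obtain ⟨y₂, h2⟩ := DFunLike.ne_iff.1 (hq0 (σ 2) (σ 3))
  obtain ⟨y₃, h3⟩ := DFunLike.ne_iff.1 h2
  have h3' : q (σ 2) (σ 3) y₂ y₃ ≠ 0 := h3
  obtain ⟨c₀, hc₀⟩ := hG 0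
  obtain ⟨c₁, hc₁⟩ := hG 1
  have e00 := hc₀ fun l => ![x (σ 0), B 0, y₂, y₃] (σ.symm l)
  have e01 := hc₀ fun l => ![x (σ 0), B 1, y₂, y₃] (σ.symm l)
  have e11 := hc₁ fun l => ![x (σ 0), B 1, y₂, y₃] (σ.symm l)
  simp only [Equiv.symm_apply_apply] at e00 e01 e11
  simp at e00 e01 e11
  have hne := mul_ne_zero hx h3'
  rw [← e00] at hne
  rcases e01 with h | h
  · exact hne (by rw [h, zero_mul])
  · rw [h, mul_zero] at e11
    exact mul_ne_zero hx h3' e11.symm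

end Pencil

/-! ### Three points on the product of four lines. -/

section Segre

variable {K : Type*} [Field K]

theorem not_proportional_segre {a b c : Point K fun _ : Fin 4 => 1}
    (F : Form K fun _ : Fin 4 => 1)
    (H : ∀ g : Form K fun _ : Fin 4 => 1,
      (∀ p ∈ ({a, b, c} : Set (Point K fun _ : Fin 4 => 1)), SingularAt g fun i => (p i).rep) →
        ∃ c : K, c • F = g) : False := by
  refine not_forall_proportional (V := Fin (1 + 1) → K) (by simp)
    ![fun i => (a i).rep, fun i => (b i).rep, fun i => (c i).rep] F fun g hg => H g ?_
  rintro p (rfl | rfl | rfl)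
  · exact hg 0
  · exact hg 1
  · exact hg 2

theorem mem_terraciniOne_segre {S : Set (Point K fun _ : Fin 4 => 1)} (hS : S.ncard = 3) :
    S ∈ terraciniOne K (fun _ : Fin 4 => 1) 3 := by
  classical
  have hfin : S.Finite := Set.finite_of_ncard_ne_zero (by omega)
  obtain ⟨a, b, c, -, -, -, rfl⟩ := Set.ncard_eq_three.1 hS
  refine ⟨hS, hfin, ?_, ?_⟩
  · rw [h0_pos_iff (by norm_num)]
    by_contra! h
    refine not_proportional_segre (a := a) (b := b) (c := c) 0 fun g hg => ⟨0, ?_⟩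
    by_contra hne
    obtain ⟨p, hp, hp'⟩ := h g fun h0 => hne (by rw [h0, smul_zero])
    exact hp' (hg p hp)
  · rw [defect_pos_iff hfin]
    intro htop
    have := hfin.fintype
    have h1 := (restrict ({a, b, c} : Set (Point K fun _ : Fin 4 => 1))).finrank_range_add_finrank_ker
    have h2 := finrank_form_le (K := K) (n := fun _ : Fin 4 => 1)
    -- Each of the three jet spaces has dimension at least 1 + 8 - 4 = 5. If restriction were onto,
    -- the kernel would have dimension at most 16 - 15 = 1.
    have h3 : 15 ≤ Module.finrank K
        (∀ p : ({a, b, c} : Set (Point K fun _ : Fin 4 => 1)), jets p.1) := by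
      rw [Module.finrank_pi_fintype]
      refine le_trans ?_ (Finset.card_nsmul_le_sum Finset.univ _ 5 fun p _ => ?_)
      · rw [Finset.card_univ, ← Nat.card_eq_fintype_card, Nat.card_coe_set_eq, hS]
        norm_num
      · have := le_finrank_jets p.1
        simp at this
        omega
    rw [htop, finrank_top] at h1
    simp only [Finset.prod_const, Finset.card_univ, Fintype.card_fin] at h2
    have hle : Module.finrank K
        (LinearMap.ker (restrict ({a, b, c} : Set (Point K fun _ : Fin 4 => 1)))) ≤ 1 := by omega
    have : Module.Free K
        (LinearMap.ker (restrict ({a, b, c} : Set (Point K fun _ : Fin 4 => 1)))) :=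
      Module.Free.of_divisionRing K
        (LinearMap.ker (restrict ({a, b, c} : Set (Point K fun _ : Fin 4 => 1))))
    obtain ⟨F, hF⟩ := (finrank_le_one_iff (K := K)
      (V := LinearMap.ker (restrict ({a, b, c} : Set (Point K fun _ : Fin 4 => 1))))).1 hle
    refine not_proportional_segre (a := a) (b := b) (c := c) F.1 fun g hg => ?_
    obtain ⟨t, ht⟩ := hF ⟨g, (mem_ker_restrict_iff (by norm_num)).2 hg⟩
    exact ⟨t, congrArg Subtype.val ht⟩

end Segre

end Multiproj

theorem theorem4 (K : Type*) [Field K] [IsAlgClosed K] [CharZero K] (k : ℕ) (hk : 1 ≤ k)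
    (n : Fin k → ℕ)
    (hY : ∃ S₀ : Set (Multiproj.Point K n), S₀.ncard = 3 ∧ Multiproj.IsMinimalFor S₀) :
    (Multiproj.terracini K n 3 = ∅ ↔
      k ≤ 2 ∨ 3 ≤ (Finset.univ.filter fun i : Fin k => n i = 2).card) ∧
    (∀ S ∈ Multiproj.terracini K n 3,
      Multiproj.IsFirstExample S ∨ Multiproj.IsSecondExample S ∨ (k = 4 ∧ ∀ i, n i = 1)) ∧
    ((k = 4 ∧ ∀ i, n i = 1) →
      ∀ S : Set (Multiproj.Point K n), S.ncard = 3 →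
        S ∈ Multiproj.terraciniOne K n 3 ∧
        (Multiproj.IsMinimalFor S → S ∈ Multiproj.terracini K n 3)) := by
  obtain ⟨S₀, hS₀, hmin₀⟩ := hY
  have hn := hmin₀.eq_one_or_two hS₀
  refine ⟨⟨fun hempty => ?_, fun h => ?_⟩, ?_, ?_⟩
  · by_contra! h
    -- The set of planes, of size at most two, is enlarged to exactly two indices, which become the
    -- special factors `i₁` and `i₂`.
    obtain ⟨T, hT, hTcard⟩ := Finset.exists_subsuperset_card_eq (n := 2)
      (Finset.subset_univ (Finset.univ.filter fun i : Fin k => n i = 2)) (by omega)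
      (by rw [Finset.card_univ, Fintype.card_fin]; omega)
    obtain ⟨i₁, i₂, hne, rfl⟩ := Finset.card_eq_two.1 hTcard.2
    refine (Multiproj.terracini_nonempty (K := K) (by omega) hn hne fun i hi => ?_).ne_empty hempty
    simpa using hT (Finset.mem_filter.2 ⟨Finset.mem_univ i, hi⟩)
  · rw [Set.eq_empty_iff_forall_notMem]
    rintro S ⟨⟨hcard, -, h0, hd⟩, hmin⟩
    rcases h with h | h
    · obtain ⟨f, hf0, hf⟩ := (Multiproj.h0_pos_iff hk).1 h0
      exact hf0 (Multiproj.eq_zero_of_le_two hmin hk h hf)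
    · obtain ⟨a, b, c, -, -, -, rfl⟩ := Set.ncard_eq_three.1 hcard
      rw [Multiproj.defect_eq_zero_of_three_planes hmin h] at hd
      exact lt_irrefl _ hd
  · rintro S ⟨⟨hcard, -, h0, hd⟩, hmin⟩
    obtain ⟨a, b, c, hab, hac, hbc, rfl⟩ := Set.ncard_eq_three.1 hcard
    exact Multiproj.classification hmin hk hn hab hbc hac.symm h0 hd
  · rintro ⟨rfl, h1⟩ S hS
    obtain rfl : n = fun _ => 1 := funext h1
    have := Multiproj.mem_terraciniOne_segre hS
    exact ⟨this, fun hmin => ⟨this, hmin⟩⟩
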